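/- Let $k \ge n \ge 2$ be integers, put $s = s(n,k) = (k+n)(\log(k+n))^2$, and let $H \ge 1$ be a real number with $\log H \ge s\,e^{s}$. Put $$\omega(k,H) = k + \frac{k^2\log k}{\log\log H}\,d(k), \qquad d(2)=3.319,\quad d(3)=1.145,\quad d(4)=1.114,\quad d(k) = 1+\frac{0.69}{\log k-1}\ \ (k\ge 5).$$ Then for all integers $\lambda_0,\dots,\lambda_k$, not all zero, with $\max_{1\le i\le k}|\lambda_i|\le H$ (no condition on $\lambda_0$), $$\left|\lambda_0+\lambda_1e^{1/n}+\lambda_2e^{2/n}+\dots+\lambda_ke^{k/n}\right| > H^{-\omega(k,H)}.$$ In particular $\omega(k,H)$ is a transcendence measure of $e^{1/n}$ for these $k$ and $H$: it is at least the infimum of all $r>0$ such that $|\lambda_0+\lambda_1e^{1/n}+\dots+\lambda_ke^{k/n}|>H^{-r}$ for all integers $\lambda_0,\dots,\lambda_k$, not all zero, with $\max_{1\le i\le k}|\lambda_i|\le H$. -/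

import Mathlib

namespace RootsOfE

/-- `s(n, k) = (k + n) (log (k + n))²`. -/
noncomputable def s (n k : ℕ) : ℝ :=
  ((k : ℝ) + n) * Real.log ((k : ℝ) + n) ^ 2

/-- The factor multiplying `k² log k / log log H`: the constants `d(2)`, `d(3)`, `d(4)`,
and `1 + 0.69 / (log k - 1)` for `k ≥ 5` (only used for `k ≥ 2`). -/
noncomputable def factor (k : ℕ) : ℝ :=
  if k = 2 then 3.319
  else if k = 3 then 1.145
  else if k = 4 then 1.114
  else 1 + 0.69 / (Real.log k - 1)

/-- The explicit exponent `k + (k² log k / log log H) * factor k`. -/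
noncomputable def explicitExponent (k : ℕ) (H : ℝ) : ℝ :=
  (k : ℝ) + (k : ℝ) ^ 2 * Real.log k / Real.log (Real.log H) * factor k

/-- `r` is such that `|λ₀ + λ₁ ξ + ⋯ + λₖ ξᵏ| > 1 / H ^ r` for all integer vectors
`(λ₀, …, λₖ) ≠ 0` with `max_{1 ≤ i ≤ k} |λᵢ| ≤ H` (there is no condition on `λ₀`). -/
def IsLowerBoundExponent (ξ : ℝ) (k : ℕ) (H r : ℝ) : Prop :=
  ∀ c : Fin (k + 1) → ℤ, c ≠ 0 → (∀ i, i ≠ 0 → |(c i : ℝ)| ≤ H) →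
    1 / H ^ r < |∑ i, (c i : ℝ) * ξ ^ (i : ℕ)|

/-- The optimal exponent: the infimum of the `r > 0` that satisfy `IsLowerBoundExponent`.
A transcendence measure of `ξ` is any upper bound for it. -/
noncomputable def optimalExponent (ξ : ℝ) (k : ℕ) (H : ℝ) : ℝ :=
  sInf {r : ℝ | 0 < r ∧ IsLowerBoundExponent ξ k H r}

end RootsOfE

/-
Effective transcendence measure for roots of `e`, by Hermite's simultaneous approximations
to the exponential function.
-/

/-! ### Hermite's polynomials: differential equation, divisibility, nonsingularity. -/

namespace RootsOfE
open Polynomial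

/-! If `F - n F' = f`, then `e^{-x/n} F(x)` has derivative `-e^{-x/n} f(x) / n`. So if `f` is small
on `[0, k]`, the ratios `F(j) / F(0)` approximate all the `e^{j/n}`, `0 ≤ j ≤ k`, at once. Hermite's
choice is `f_m = ∏_j (X - j)^{p+1} / (X - m)`: its high-order zeros make every `F_m(j)` an integer
multiple of `p! n^p`.

The matrix `F_m(j)` is nonsingular (`eq_zero_of_sum_mul_eval_derivSum_eq_zero`), so some `∑ c_j
F_m(j)` is nonzero, hence at least `p! n^p` in absolute value. It differs from `F_m(0) Λ`, with `Λ`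
the linear form, by less than half of that once `p!` exceeds `H (k!/(4n))^p` times a constant
depending on `k`. Then `|Λ| > p! n^p / (2 |F_m(0)|)` (`half_lt_abs_linearForm_mul`).

Take the least such `p`. Up to lower-order terms, failure at `p - 1` gives `log p! ≤ log H + p log
(k!/(4n))`. This turns the main loss `k log p!` into `k log H`, and by Stirling it also gives `p ≤ c
log H / log log H` (`le_mul_div_log`). The third clause of `IsAdmissible` serves this bound on `p`;
the fourth says that the second term of the exponent pays for what `p` still multiplies, `(k+1) log
(k+1) + k log (k!/4)`, and for the errors. -/

/-- `∑_{i < N} nⁱ f⁽ⁱ⁾`; for `deg f < N` it is the solution `F` of `F - n F' = f`. -/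
noncomputable def derivSum {R : Type*} [CommRing R] (n N : ℕ) (f : R[X]) : R[X] :=
  ∑ i ∈ Finset.range N, C ((n : R) ^ i) * derivative^[i] f

section derivSum
variable {R : Type*} [CommRing R] (n N : ℕ)

theorem derivSum_sub (f : R[X]) (hf : f.natDegree < N) :
    derivSum n N f - C (n : R) * derivative (derivSum n N f) = f := by
  -- The sum telescopes, leaving a derivative of order `M`, which is zero for `M = N > deg f`.
  have h : ∀ M, derivSum n M f - C (n : R) * derivative (derivSum n M f)
      = f - C ((n : R) ^ M) * derivative^[M] f := by
    intro M
    induction M with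
    | zero => simp [derivSum]
    | succ M ih =>
      have e : derivSum n (M + 1) f = derivSum n M f + C ((n : R) ^ M) * derivative^[M] f := by
        rw [derivSum, Finset.sum_range_succ]; rfl
      rw [e, derivative_add, derivative_C_mul, Function.iterate_succ_apply', pow_succ, C_mul]
      linear_combination ih
  rw [h, iterate_derivative_eq_zero hf]
  simp

theorem natDegree_derivSum_le (f : R[X]) : (derivSum n N f).natDegree ≤ f.natDegree := by
  refine natDegree_sum_le_of_forall_le _ _ fun i _ => ?_
  refine (natDegree_C_mul_le _ _).trans ?_
  exact (natDegree_iterate_derivative f i).trans (Nat.sub_le _ _)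

theorem map_derivSum {S : Type*} [CommRing S] (φ : R →+* S) (f : R[X]) :
    (derivSum n N f).map φ = derivSum n N (f.map φ) := by
  simp [derivSum, Polynomial.map_sum, iterate_derivative_map]

theorem derivSum_sum {ι : Type*} (t : Finset ι) (c : ι → R) (f : ι → R[X]) :
    derivSum n N (∑ m ∈ t, C (c m) * f m) = ∑ m ∈ t, C (c m) * derivSum n N (f m) := by
  simp only [derivSum, Finset.mul_sum, iterate_derivative_sum, iterate_derivative_C_mul]
  rw [Finset.sum_comm]
  refine Finset.sum_congr rfl fun _ _ => Finset.sum_congr rfl fun _ _ => ?_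
  ring

/-- Derivatives of order below `p` vanish at `a`. From order `i ≥ p` on, the derivative is `i!`
times a Hasse derivative, which has coefficients in `R`, and `p! ∣ i!`. -/
theorem factorial_mul_pow_dvd_eval_derivSum (f : R[X]) (a : R) (p : ℕ) (h : (X - C a) ^ p ∣ f) :
    ((p.factorial : R) * (n : R) ^ p) ∣ (derivSum n N f).eval a := by
  rw [derivSum, eval_finsetSum]
  refine Finset.dvd_sum fun i _ => ?_
  rw [eval_mul, eval_C]
  rcases lt_or_ge i p with hi | hi
  · have h1 : (X - C a) ^ (p - i) ∣ derivative^[i] f := pow_sub_dvd_iterate_derivative_of_pow_dvd i h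
    have h2 : (X - C a) ∣ derivative^[i] f := (dvd_pow_self _ (by omega)).trans h1
    rw [dvd_iff_isRoot.1 h2]
    simp
  · rw [← factorial_smul_hasseDeriv, LinearMap.smul_apply, nsmul_eq_mul, eval_mul, eval_natCast,
      mul_comm ((p.factorial : R))]
    refine mul_dvd_mul (pow_dvd_pow _ hi) (dvd_mul_of_dvd_left ?_ _)
    exact Nat.cast_dvd_cast (Nat.factorial_dvd_factorial hi)

end derivSum

/-- If the multiplicity `r` of the root `a` of `G` were at most `p`, then `(X - a)^r` would divide
both `G` and `G - b G'`, hence `G'`, where the multiplicity is only `r - 1`. -/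
theorem pow_succ_dvd_of_pow_dvd_sub {G : ℝ[X]} {a b : ℝ} {p : ℕ} (hG : G.eval a = 0)
    (h : (X - C a) ^ p ∣ G - C b * derivative G) (hb : b ≠ 0) : (X - C a) ^ (p + 1) ∣ G := by
  by_cases h0 : G = 0
  · simp [h0]
  rw [← le_rootMultiplicity_iff h0]
  by_contra! hlt
  have hpos : 0 < G.rootMultiplicity a := (rootMultiplicity_pos h0).2 hG
  have hr := derivative_rootMultiplicity_of_root (p := G) (t := a) hG
  have hd : derivative G ≠ 0 := by
    intro hd
    have := derivative_eq_zero.1 hd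
    rw [eq_C_of_natDegree_eq_zero this] at hG h0
    simp at hG
    simp [hG] at h0
  have h1 : (X - C a) ^ (G.rootMultiplicity a) ∣ G := pow_rootMultiplicity_dvd _ _
  have h2 : (X - C a) ^ (G.rootMultiplicity a) ∣ G - C b * derivative G :=
    (pow_dvd_pow _ (by omega)).trans h
  have h3 : (X - C a) ^ (G.rootMultiplicity a) ∣ derivative G := by
    have := (dvd_sub h1 h2).mul_left (C b⁻¹)
    have e : C b⁻¹ * (G - (G - C b * derivative G)) = derivative G := by
      have : C b⁻¹ * C b = (1 : ℝ[X]) := by rw [← C_mul, inv_mul_cancel₀ hb, C_1]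
      linear_combination derivative G * this
    rwa [e] at this
  rw [← le_rootMultiplicity_iff hd] at h3
  omega

/-- `X (X - 1) ⋯ (X - k)`. -/
noncomputable def nodePoly (R : Type*) [CommRing R] (k : ℕ) : R[X] :=
  ∏ j ∈ Finset.range (k + 1), (X - C (j : R))

/-- `X (X - 1) ⋯ (X - k)` without the factor `X - m`. -/
noncomputable def nodePolyErase (R : Type*) [CommRing R] (k m : ℕ) : R[X] :=
  ∏ j ∈ (Finset.range (k + 1)).erase m, (X - C (j : R))

/-- The `m`-th Hermite polynomial `∏_j (X - j)^{p + 1} / (X - m)`. -/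
noncomputable def hermitePoly (R : Type*) [CommRing R] (k p m : ℕ) : R[X] :=
  nodePoly R k ^ p * nodePolyErase R k m

section hermite
variable {R : Type*} [CommRing R]

theorem nodePoly_monic (k : ℕ) : (nodePoly R k).Monic :=
  monic_prod_of_monic _ _ fun _ _ => monic_X_sub_C _

theorem nodePolyErase_monic (k m : ℕ) : (nodePolyErase R k m).Monic :=
  monic_prod_of_monic _ _ fun _ _ => monic_X_sub_C _

theorem hermitePoly_monic (k p m : ℕ) : (hermitePoly R k p m).Monic :=
  ((nodePoly_monic k).pow p).mul (nodePolyErase_monic k m)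

theorem natDegree_nodePoly [Nontrivial R] (k : ℕ) : (nodePoly R k).natDegree = k + 1 := by
  rw [nodePoly, natDegree_prod_of_monic _ _ fun _ _ => monic_X_sub_C _,
    Finset.sum_congr rfl fun _ _ => natDegree_X_sub_C _]
  simp

theorem natDegree_nodePolyErase [Nontrivial R] {k m : ℕ} (hm : m ≤ k) :
    (nodePolyErase R k m).natDegree = k := by
  rw [nodePolyErase, natDegree_prod_of_monic _ _ fun _ _ => monic_X_sub_C _,
    Finset.sum_congr rfl fun _ _ => natDegree_X_sub_C _]
  simp [Finset.card_erase_of_mem (Finset.mem_range.2 (Nat.lt_succ_of_le hm))]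

theorem natDegree_hermitePoly [Nontrivial R] {k m : ℕ} (p : ℕ) (hm : m ≤ k) :
    (hermitePoly R k p m).natDegree = (k + 1) * p + k := by
  rw [hermitePoly, ((nodePoly_monic k).pow p).natDegree_mul (nodePolyErase_monic k m),
    (nodePoly_monic k).natDegree_pow, natDegree_nodePoly, natDegree_nodePolyErase hm, mul_comm]

theorem map_hermitePoly {S : Type*} [CommRing S] (φ : R →+* S) (k p m : ℕ) :
    (hermitePoly R k p m).map φ = hermitePoly S k p m := by
  simp [hermitePoly, nodePoly, nodePolyErase, Polynomial.map_prod]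

theorem X_sub_C_pow_dvd_nodePoly_pow {k j : ℕ} (p : ℕ) (hj : j ≤ k) :
    (X - C (j : R)) ^ p ∣ nodePoly R k ^ p :=
  pow_dvd_pow_of_dvd (Finset.dvd_prod_of_mem (fun j : ℕ => X - C (j : R))
    (Finset.mem_range.2 (Nat.lt_succ_of_le hj))) p

end hermite

/-- The matrix of values of `derivSum` of the Hermite polynomials at the nodes is nonsingular. -/
theorem eq_zero_of_sum_mul_eval_derivSum_eq_zero {n k p N : ℕ} (hn : n ≠ 0)
    (hN : (k + 1) * p + k < N) (c : Fin (k + 1) → ℝ)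
    (hc : ∀ m : Fin (k + 1),
      ∑ j : Fin (k + 1), (derivSum n N (hermitePoly ℝ k p m)).eval ((j : ℕ) : ℝ) * c j = 0) :
    c = 0 := by
  by_contra hne
  have hdet : (Matrix.of fun m j : Fin (k + 1) =>
      (derivSum n N (hermitePoly ℝ k p m)).eval ((j : ℕ) : ℝ)).det = 0 :=
    Matrix.exists_mulVec_eq_zero_iff.1 ⟨c, hne, funext fun m => hc m⟩
  -- A left kernel vector combines the Hermite polynomials into one `g` whose `G` vanishes at every
  -- node.
  obtain ⟨v, hv, hv0⟩ := Matrix.exists_vecMul_eq_zero_iff.2 hdet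
  set h : ℝ[X] := ∑ m : Fin (k + 1), C (v m) * nodePolyErase ℝ k m with hh
  set g : ℝ[X] := ∑ m : Fin (k + 1), C (v m) * hermitePoly ℝ k p m with hg
  have hgh : g = nodePoly ℝ k ^ p * h := by
    rw [hg, hh, Finset.mul_sum]
    refine Finset.sum_congr rfl fun m _ => ?_
    rw [hermitePoly]; ring
  have hgdeg : g.natDegree ≤ (k + 1) * p + k := by
    refine natDegree_sum_le_of_forall_le _ _ fun m _ => ?_
    refine (natDegree_C_mul_le _ _).trans ?_
    rw [natDegree_hermitePoly p (Nat.le_of_lt_succ m.2)]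
  set G := derivSum n N g with hG
  have hGg : G - C (n : ℝ) * derivative G = g := derivSum_sub n N g (hgdeg.trans_lt hN)
  have hroot : ∀ j ∈ Finset.range (k + 1), (X - C (j : ℝ)) ^ (p + 1) ∣ G := by
    intro j hj
    refine pow_succ_dvd_of_pow_dvd_sub (b := (n : ℝ)) ?_ ?_ (by exact_mod_cast hn)
    · rw [hG, hg, derivSum_sum, eval_finsetSum]
      have := congrFun hv0 ⟨j, Finset.mem_range.1 hj⟩
      simpa [Matrix.vecMul, dotProduct] using this
    · rw [hGg, hgh]
      exact (X_sub_C_pow_dvd_nodePoly_pow p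
        (Nat.le_of_lt_succ (Finset.mem_range.1 hj))).mul_right _
  have hdvd : nodePoly ℝ k ^ (p + 1) ∣ G := by
    rw [nodePoly, ← Finset.prod_pow]
    refine Finset.prod_dvd_of_coprime ?_ hroot
    intro i _ j _ hij
    refine IsCoprime.pow ?_
    exact isCoprime_X_sub_C_of_isUnit_sub (sub_ne_zero.2 (by exact_mod_cast hij)).isUnit
  -- `G` has `(k+1)(p+1)` zeros with multiplicity, one more than its degree allows.
  have hG0 : G = 0 := by
    refine eq_zero_of_dvd_of_natDegree_lt hdvd ?_
    rw [(nodePoly_monic k).natDegree_pow, natDegree_nodePoly]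
    refine ((natDegree_derivSum_le n N g).trans hgdeg).trans_lt ?_
    linarith [mul_comm (p + 1) (k + 1)]
  have hg0 : g = 0 := by rw [← hGg, hG0]; simp
  have hh0 : h = 0 := by
    rw [hgh] at hg0
    exact (mul_eq_zero.1 hg0).resolve_left ((nodePoly_monic k).pow p).ne_zero
  -- Lagrange interpolation: at the node `m` only the `m`-th summand of `h` survives.
  apply hv
  funext m
  have hm := congrArg (eval ((m : ℕ) : ℝ)) hh0
  rw [hh, eval_finsetSum, Finset.sum_eq_single m] at hm
  · rw [eval_mul, eval_C, eval_zero] at hm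
    refine (mul_eq_zero.1 hm).resolve_right ?_
    rw [nodePolyErase, eval_prod, ← ne_eq, Finset.prod_ne_zero_iff]
    intro j hj
    have := Finset.ne_of_mem_erase hj
    rw [eval_sub, eval_X, eval_C, sub_ne_zero]
    exact_mod_cast this.symm
  · intro j _ hj
    rw [eval_mul, nodePolyErase, eval_prod]
    have hmem : (m : ℕ) ∈ (Finset.range (k + 1)).erase (j : ℕ) :=
      Finset.mem_erase.2 ⟨fun e => hj (Fin.ext e.symm), Finset.mem_range.2 m.2⟩
    rw [Finset.prod_eq_zero hmem (by simp), mul_zero]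
  · simp

end RootsOfE

/-! ### Size of the Hermite polynomials, of `F(0)` and of the remainders. -/

namespace RootsOfE
open Polynomial

theorem factorial_mul_factorial_le_factorial_add (a b : ℕ) :
    (a + 1).factorial * (b + 1).factorial ≤ (a + b + 1).factorial := by
  induction b with
  | zero => simp
  | succ b ih =>
    rw [Nat.factorial_succ (b + 1), show a + (b + 1) + 1 = (a + b + 1) + 1 by ring,
      Nat.factorial_succ (a + b + 1), mul_left_comm]
    exact Nat.mul_le_mul (by omega) ih

/-- The factors are the largest distances from the node `j` to a point of `[i, i+1]`. -/
theorem prod_range_nodeDist (i b : ℕ) :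
    ∏ j ∈ Finset.range (i + 1 + (b + 1)), (if j ≤ i then i + 1 - j else j - i)
      = (i + 1).factorial * (b + 1).factorial := by
  rw [Finset.prod_range_add]
  congr 1
  · rw [← Finset.prod_range_add_one_eq_factorial, ← Finset.prod_range_reflect]
    refine Finset.prod_congr rfl fun j hj => ?_
    rw [Finset.mem_range] at hj
    rw [if_pos (by omega)]
    omega
  · rw [← Finset.prod_range_add_one_eq_factorial]
    refine Finset.prod_congr rfl fun j _ => ?_
    rw [if_neg (by omega)]
    omega

theorem exists_nat_le_le_add_one {k : ℕ} (hk : 1 ≤ k) {x : ℝ} (h0 : 0 ≤ x) (hx : x ≤ k) :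
    ∃ i : ℕ, i + 1 ≤ k ∧ (i : ℝ) ≤ x ∧ x ≤ i + 1 := by
  rcases hx.lt_or_eq with h | h
  · exact ⟨⌊x⌋₊, (Nat.floor_lt h0).2 h, Nat.floor_le h0, (Nat.lt_floor_add_one x).le⟩
  -- At `x = k` the floor would give an interval outside `[0, k]`.
  · refine ⟨k - 1, by omega, ?_, ?_⟩ <;> push_cast [Nat.cast_sub hk] <;> linarith

theorem abs_sub_natCast_le {i : ℕ} {x : ℝ} (h1 : (i : ℝ) ≤ x) (h2 : x ≤ i + 1) (j : ℕ) :
    |x - j| ≤ ((if j ≤ i then i + 1 - j else j - i : ℕ) : ℝ) := by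
  split_ifs with h
  · have : (j : ℝ) ≤ i := by exact_mod_cast h
    rw [Nat.cast_sub (by omega), abs_of_nonneg (by linarith)]
    push_cast; linarith
  · have : (i : ℝ) + 1 ≤ j := by exact_mod_cast Nat.lt_of_not_le h
    rw [Nat.cast_sub (by omega), abs_of_nonpos (by linarith)]
    linarith

theorem prod_nodeDist_le {i k : ℕ} (hi : i + 1 ≤ k) :
    ∏ j ∈ Finset.range (k + 1), ((if j ≤ i then i + 1 - j else j - i : ℕ) : ℝ) ≤ k.factorial := by
  obtain ⟨b, rfl⟩ := Nat.exists_eq_add_of_le hi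
  rw [← Nat.cast_prod, show i + 1 + b + 1 = i + 1 + (b + 1) by ring, prod_range_nodeDist]
  have := factorial_mul_factorial_le_factorial_add i b
  rw [show i + 1 + b = i + b + 1 by ring]
  exact_mod_cast this

theorem abs_eval_nodePolyErase_le {k m : ℕ} (hk : 1 ≤ k) {x : ℝ} (h0 : 0 ≤ x)
    (hx : x ≤ k) : |(nodePolyErase ℝ k m).eval x| ≤ k.factorial := by
  obtain ⟨i, hi, h1, h2⟩ := exists_nat_le_le_add_one hk h0 hx
  rw [nodePolyErase, eval_prod, Finset.abs_prod]
  simp only [eval_sub, eval_X, eval_C]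
  refine (Finset.prod_le_prod (fun _ _ => abs_nonneg _)
    fun j _ => abs_sub_natCast_le h1 h2 j).trans (le_trans ?_ (prod_nodeDist_le hi))
  rw [← Nat.cast_prod, ← Nat.cast_prod]
  -- Every majorant is at least 1, so restoring the missing factor only enlarges the product.
  refine Nat.cast_le.2 (Finset.prod_le_prod_of_subset_of_one_le' (Finset.erase_subset _ _) ?_)
  intro j _ _
  split_ifs <;> omega

theorem abs_eval_nodePoly_le {k : ℕ} (hk : 1 ≤ k) {x : ℝ} (h0 : 0 ≤ x) (hx : x ≤ k) :
    |(nodePoly ℝ k).eval x| ≤ k.factorial / 4 := by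
  obtain ⟨i, hi, h1, h2⟩ := exists_nat_le_le_add_one hk h0 hx
  have hm : i ∈ Finset.range (k + 1) := Finset.mem_range.2 (by omega)
  have hm' : i + 1 ∈ (Finset.range (k + 1)).erase i :=
    Finset.mem_erase.2 ⟨by omega, Finset.mem_range.2 (by omega)⟩
  have hw := prod_nodeDist_le hi
  rw [← Finset.mul_prod_erase _ _ hm, ← Finset.mul_prod_erase _ _ hm'] at hw
  simp only [le_refl, if_true, Nat.add_sub_cancel_left, Nat.cast_one, one_mul,
    show ¬ (i + 1 ≤ i) by omega, if_false] at hw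
  rw [nodePoly, eval_prod, Finset.abs_prod, ← Finset.mul_prod_erase _ _ hm,
    ← Finset.mul_prod_erase _ _ hm', ← mul_assoc]
  simp only [eval_sub, eval_X, eval_C]
  -- The two nodes around `x` have majorant 1 but contribute at most `1/4` together; this is the
  -- origin of the 4 in `k!/(4n)`.
  have h4 : |x - i| * |x - (i + 1 : ℕ)| ≤ 1 / 4 := by
    rw [abs_of_nonneg (by linarith), abs_of_nonpos (by push_cast; linarith)]
    push_cast
    nlinarith [sq_nonneg (x - i - 1 / 2)]
  have hp := (Finset.prod_le_prod (s := ((Finset.range (k + 1)).erase i).erase (i + 1))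
    (fun j _ => abs_nonneg (x - (j : ℝ))) fun j _ => abs_sub_natCast_le h1 h2 j).trans hw
  calc _ ≤ 1 / 4 * (k.factorial : ℝ) :=
        mul_le_mul h4 hp (Finset.prod_nonneg fun _ _ => abs_nonneg _) (by norm_num)
    _ = _ := by ring

theorem abs_eval_hermitePoly_le {k : ℕ} (p m : ℕ) (hk : 1 ≤ k) {x : ℝ} (h0 : 0 ≤ x) (hx : x ≤ k) :
    |(hermitePoly ℝ k p m).eval x| ≤ (k.factorial / 4 : ℝ) ^ p * k.factorial := by
  rw [hermitePoly, eval_mul, eval_pow, abs_mul, abs_pow]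
  gcongr
  · exact abs_eval_nodePoly_le hk h0 hx
  · exact abs_eval_nodePolyErase_le hk h0 hx

/-- `F(0) = ∑ nⁱ i! aᵢ`, and Vieta bounds `|aᵢ|` by `b^{d-i} (d choose i)`. The sum then becomes `d!
n^d` times a partial sum of the series of `e^{b/n}`. -/
theorem abs_eval_zero_derivSum_le {n N : ℕ} (hn : n ≠ 0) {f : ℝ[X]} {b : ℝ} (hb : 0 ≤ b)
    (hf : f.Monic) (hs : f.Splits) (hr : ∀ z ∈ f.roots, ‖z‖ ≤ b) (hN : N = f.natDegree + 1) :
    |(derivSum n N f).eval 0| ≤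
      f.natDegree.factorial * (n : ℝ) ^ f.natDegree * Real.exp (b / n) := by
  set d := f.natDegree with hd
  have hn0 : (0 : ℝ) < n := by exact_mod_cast Nat.pos_of_ne_zero hn
  have hc : ∀ i, |f.coeff i| ≤ b ^ (d - i) * d.choose i := by
    intro i
    have := coeff_le_of_roots_le (f := RingHom.id ℝ) (B := b) i hf (by simpa using hs)
      (by simpa using hr)
    simpa using this
  rw [derivSum, eval_finsetSum]
  have h1 : ∀ i ∈ Finset.range N, |(C ((n : ℝ) ^ i) * derivative^[i] f).eval 0| ≤
      d.factorial * (n : ℝ) ^ d * ((b / n) ^ (d - i) / (d - i).factorial) := by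
    intro i hi
    have hid : i ≤ d := by rw [Finset.mem_range] at hi; omega
    rw [eval_mul, eval_C, ← coeff_zero_eq_eval_zero, coeff_iterate_derivative, zero_add,
      Nat.descFactorial_self, nsmul_eq_mul, abs_mul, abs_mul, abs_of_nonneg (by positivity),
      Nat.abs_cast]
    have e : (d.factorial : ℝ) = i.factorial * (d - i).factorial * d.choose i := by
      rw [← Nat.choose_mul_factorial_mul_factorial hid]; push_cast; ring
    calc (n : ℝ) ^ i * (i.factorial * |f.coeff i|)
        ≤ (n : ℝ) ^ i * (i.factorial * (b ^ (d - i) * d.choose i)) := by gcongr; exact hc i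
      _ = _ := by
          rw [e, show (n : ℝ) ^ d = n ^ i * n ^ (d - i) by rw [← pow_add]; congr 1; omega, div_pow]
          have := Nat.factorial_ne_zero (d - i)
          field_simp
  refine (Finset.abs_sum_le_sum_abs _ _).trans ((Finset.sum_le_sum h1).trans ?_)
  rw [← Finset.mul_sum, hN]
  gcongr
  have := Finset.sum_range_reflect (fun j => (b / n) ^ j / (j.factorial : ℝ)) (d + 1)
  simp only [Nat.add_sub_cancel] at this
  rw [this]
  exact Real.sum_le_exp_of_nonneg (by positivity) _

/-- Mean value inequality for `e^{-x/n} F(x)` on `[0, b]`, multiplied by `e^{b/n}`. -/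
theorem abs_eval_zero_mul_exp_sub_le {n N : ℕ} (hn : n ≠ 0) {f : ℝ[X]} (hN : f.natDegree < N)
    {b M : ℝ} (hb : 0 ≤ b) (hM : ∀ x, 0 ≤ x → x ≤ b → |f.eval x| ≤ M) :
    |(derivSum n N f).eval 0 * Real.exp (b / n) - (derivSum n N f).eval b| ≤
      b / n * Real.exp (b / n) * M := by
  have hn0 : (0 : ℝ) < n := by exact_mod_cast Nat.pos_of_ne_zero hn
  set F := derivSum n N f with hF
  have hFf : ∀ x, F.eval x - n * F.derivative.eval x = f.eval x := by
    intro x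
    have := congrArg (eval x) (derivSum_sub n N f hN)
    simpa using this
  have hder : ∀ x : ℝ, HasDerivAt (fun x => Real.exp (-x / n) * F.eval x)
      (-(Real.exp (-x / n) * f.eval x / n)) x := by
    intro x
    have h1 : HasDerivAt (fun x : ℝ => Real.exp (-x / n)) (Real.exp (-x / n) * (-1 / n)) x :=
      ((hasDerivAt_id x).neg.div_const _).exp
    refine (h1.mul (F.hasDerivAt x)).congr_deriv ?_
    rw [← hFf]
    field_simp
    ring
  have hM0 : 0 ≤ M := (abs_nonneg _).trans (hM 0 le_rfl hb)
  have key := norm_image_sub_le_of_norm_deriv_le_segment' (a := 0) (b := b) (C := M / n)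
    (fun x _ => (hder x).hasDerivWithinAt) (by
      intro x hx
      rw [norm_neg, Real.norm_eq_abs, abs_div, abs_mul, abs_of_pos (Real.exp_pos _),
        abs_of_pos hn0]
      gcongr
      calc Real.exp (-x / n) * |f.eval x| ≤ 1 * M := by
            gcongr
            · rw [Real.exp_le_one_iff]
              exact div_nonpos_of_nonpos_of_nonneg (by linarith [hx.1]) hn0.le
            · exact hM x hx.1 hx.2.le
        _ = M := one_mul M) b ⟨hb, le_rfl⟩
  simp only [neg_zero, zero_div, Real.exp_zero, one_mul, sub_zero, Real.norm_eq_abs] at key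
  have e : F.eval 0 * Real.exp (b / n) - F.eval b
      = -(Real.exp (b / n) * (Real.exp (-b / n) * F.eval b - F.eval 0)) := by
    have : Real.exp (b / n) * Real.exp (-b / n) = 1 := by
      rw [← Real.exp_add, neg_div, add_neg_cancel, Real.exp_zero]
    linear_combination (F.eval b) * this
  rw [e, abs_neg, abs_mul, abs_of_pos (Real.exp_pos _)]
  calc _ ≤ Real.exp (b / n) * (M / n * b) := by gcongr
    _ = _ := by ring

theorem hermitePoly_splits (k p m : ℕ) : (hermitePoly ℝ k p m).Splits := by
  refine Splits.mul (Splits.pow ?_ _) ?_ <;>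
  · refine Splits.prod fun j _ => ?_
    exact Splits.X_sub_C _

theorem norm_le_of_mem_roots_hermitePoly {k p m : ℕ} {z : ℝ}
    (hz : z ∈ (hermitePoly ℝ k p m).roots) : ‖z‖ ≤ k := by
  have h := (mem_roots'.1 hz).2
  rw [IsRoot.def, hermitePoly, eval_mul, eval_pow, nodePoly, nodePolyErase, eval_prod, eval_prod,
    mul_eq_zero] at h
  have : ∃ j ∈ Finset.range (k + 1), (X - C (j : ℝ)).eval z = 0 := by
    rcases h with h | h
    · exact Finset.prod_eq_zero_iff.1 (by_contra fun hne => pow_ne_zero p hne h)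
    · obtain ⟨j, hj, h⟩ := Finset.prod_eq_zero_iff.1 h
      exact ⟨j, Finset.mem_of_mem_erase hj, h⟩
  obtain ⟨j, hj, h⟩ := this
  have hzj : z = j := by simpa [sub_eq_zero] using h
  rw [hzj, Real.norm_natCast]
  exact_mod_cast Nat.le_of_lt_succ (Finset.mem_range.1 hj)

end RootsOfE

/-! ### The lower bound for the linear form at a given order `p`. -/

namespace RootsOfE
open Polynomial

theorem exists_int_eval_derivSum_hermitePoly (n N : ℕ) {k j : ℕ} (p m : ℕ) (hj : j ≤ k) :
    ∃ t : ℤ, (derivSum n N (hermitePoly ℝ k p m)).eval (j : ℝ) = p.factorial * (n : ℝ) ^ p * t := by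
  -- Divisibility is taken over `ℤ` and then mapped to `ℝ`. The exponent is `p`, not `p + 1`,
  -- because `j` may equal `m`.
  have hdvd : (X - C ((j : ℤ))) ^ p ∣ hermitePoly ℤ k p m :=
    (X_sub_C_pow_dvd_nodePoly_pow p hj).mul_right _
  obtain ⟨t, ht⟩ := factorial_mul_pow_dvd_eval_derivSum n N _ _ p hdvd
  refine ⟨t, ?_⟩
  rw [← map_hermitePoly (Int.castRingHom ℝ), ← map_derivSum,
    show (j : ℝ) = Int.castRingHom ℝ (j : ℤ) by simp, eval_map_apply, ht]
  simp

theorem half_lt_abs_linearForm_mul {n k p : ℕ} (hn : 2 ≤ n) (hk : 1 ≤ k) {H : ℝ} (hH : 0 ≤ H)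
    (c : Fin (k + 1) → ℤ) (hc : c ≠ 0) (hcH : ∀ i, i ≠ 0 → |(c i : ℝ)| ≤ H)
    (hp : (k : ℝ) ^ 2 * Real.exp (k / 2) * k.factorial * H * (k.factorial / (4 * n)) ^ p
      < p.factorial) :
    1 / 2 < |∑ i, (c i : ℝ) * Real.exp (((i : ℕ) : ℝ) / (n : ℝ))| *
      (((k + 1) * p + k).factorial / p.factorial * (n : ℝ) ^ (k * (p + 1)) * Real.exp (k / 2)) := by
  have hn0 : n ≠ 0 := by omega
  have hnpos : (0 : ℝ) < n := by exact_mod_cast Nat.pos_of_ne_zero hn0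
  have hn2 : (2 : ℝ) ≤ n := by exact_mod_cast hn
  set N := (k + 1) * p + k + 1 with hN
  set Λ := ∑ i, (c i : ℝ) * Real.exp (((i : ℕ) : ℝ) / (n : ℝ)) with hΛ
  obtain ⟨m, hm⟩ : ∃ m : Fin (k + 1), ∑ j : Fin (k + 1),
      (derivSum n N (hermitePoly ℝ k p m)).eval ((j : ℕ) : ℝ) * (c j : ℝ) ≠ 0 := by
    by_contra! hall
    have := eq_zero_of_sum_mul_eval_derivSum_eq_zero hn0 (by omega) (fun j => (c j : ℝ)) hall
    exact hc (funext fun j => Int.cast_eq_zero.1 (congrFun this j))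
  set f := hermitePoly ℝ k p m with hf
  have hdeg : f.natDegree = (k + 1) * p + k := natDegree_hermitePoly p (Nat.le_of_lt_succ m.2)
  choose t ht using fun j : Fin (k + 1) =>
    exists_int_eval_derivSum_hermitePoly n N p m (Nat.le_of_lt_succ j.2)
  set D : ℝ := p.factorial * (n : ℝ) ^ p with hD
  have hDpos : 0 < D := by positivity
  set I : ℤ := ∑ j, t j * c j with hI
  have hDI : ∑ j : Fin (k + 1), (derivSum n N f).eval ((j : ℕ) : ℝ) * (c j : ℝ) = D * I := by
    rw [hI]; push_cast
    rw [Finset.mul_sum]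
    refine Finset.sum_congr rfl fun j _ => ?_
    rw [ht j]; ring
  have hI1 : (1 : ℝ) ≤ |(I : ℝ)| := by
    have : I ≠ 0 := by
      intro h0
      rw [hDI, h0] at hm
      simp at hm
    exact_mod_cast Int.one_le_abs this
  set F0 := (derivSum n N f).eval 0 with hF0
  set M : ℝ := (k.factorial / 4 : ℝ) ^ p * k.factorial with hM
  have hexp : Real.exp ((k : ℝ) / n) ≤ Real.exp (k / 2) := by
    gcongr
  have hrem : |F0 * Λ - D * I| ≤ k * (H * (k / 2 * Real.exp (k / 2) * M)) := by
    have e : F0 * Λ - D * I = ∑ j : Fin (k + 1), (c j : ℝ) *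
        (F0 * Real.exp (((j : ℕ) : ℝ) / n) - (derivSum n N f).eval ((j : ℕ) : ℝ)) := by
      rw [← hDI, hΛ, Finset.mul_sum, ← Finset.sum_sub_distrib]
      refine Finset.sum_congr rfl fun j _ => ?_
      ring
    -- The term `j = 0` is zero, which is why `c 0` needs no bound.
    rw [e, Fin.sum_univ_succ]
    simp only [Fin.val_zero, Nat.cast_zero, zero_div, Real.exp_zero, mul_one, hF0, sub_self,
      mul_zero, zero_add]
    refine (Finset.abs_sum_le_sum_abs _ _).trans ?_
    refine (Finset.sum_le_card_nsmul _ _ (H * (k / 2 * Real.exp (k / 2) * M)) ?_).trans ?_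
    · intro j _
      rw [abs_mul]
      have hjk : ((j.succ : ℕ) : ℝ) ≤ k := by exact_mod_cast Nat.le_of_lt_succ j.succ.2
      refine mul_le_mul (hcH _ (Fin.succ_ne_zero j)) ?_ (abs_nonneg _) hH
      refine (abs_eval_zero_mul_exp_sub_le hn0 (hdeg.trans_lt (Nat.lt_succ_self _)) (Nat.cast_nonneg _)
        (M := M) fun x h0 hx => abs_eval_hermitePoly_le p m hk h0 (hx.trans hjk)).trans ?_
      gcongr
    · simp
  have hsmall : k * (H * (k / 2 * Real.exp (k / 2) * M)) < D / 2 := by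
    have e1 : (k.factorial / (4 * n) : ℝ) ^ p = (k.factorial / 4 : ℝ) ^ p / (n : ℝ) ^ p := by
      rw [← div_pow, div_div]
    rw [e1, mul_div_assoc', div_lt_iff₀ (by positivity)] at hp
    rw [hM, hD]
    linarith
  have hF0Λ : D / 2 < |F0| * |Λ| := by
    rw [← abs_mul]
    have h1 : D ≤ |D * I| := by
      rw [abs_mul, abs_of_pos hDpos]
      exact le_mul_of_one_le_right hDpos.le hI1
    have h2 : |D * I| ≤ |F0 * Λ| + |F0 * Λ - D * I| := by
      have := abs_sub (F0 * Λ) (F0 * Λ - D * I)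
      simpa using this
    linarith
  have hF0le : |F0| ≤ ((k + 1) * p + k).factorial * (n : ℝ) ^ ((k + 1) * p + k) *
      Real.exp (k / 2) := by
    have := abs_eval_zero_derivSum_le hn0 (Nat.cast_nonneg k) (hermitePoly_monic k p m)
      (hermitePoly_splits k p m) (fun z hz => norm_le_of_mem_roots_hermitePoly hz)
      (N := N) (by rw [← hf, hdeg])
    rw [← hf, hdeg] at this
    refine this.trans ?_
    gcongr
  have hfin : D / 2 < ((k + 1) * p + k).factorial * (n : ℝ) ^ ((k + 1) * p + k) *
      Real.exp (k / 2) * |Λ| :=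
    hF0Λ.trans_le (by gcongr)
  have e2 : (n : ℝ) ^ ((k + 1) * p + k) = n ^ (k * (p + 1)) * n ^ p := by
    rw [← pow_add]; congr 1; ring
  have e3 : ((k + 1) * p + k).factorial * (n : ℝ) ^ ((k + 1) * p + k) * Real.exp (k / 2) * |Λ| =
      (|Λ| * (((k + 1) * p + k).factorial / p.factorial * (n : ℝ) ^ (k * (p + 1)) *
        Real.exp (k / 2))) * D := by
    rw [e2, hD]
    have := Nat.factorial_ne_zero p
    field_simp
  rw [e3] at hfin
  have : 1 / 2 * D < (|Λ| * (((k + 1) * p + k).factorial / p.factorial *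
      (n : ℝ) ^ (k * (p + 1)) * Real.exp (k / 2))) * D := by linarith
  exact lt_of_mul_lt_mul_right this hDpos.le

end RootsOfE

/-! ### Numerical estimates and admissible constants. -/

namespace RootsOfE
open Real

theorem factorial_mul_le (m p : ℕ) : (m * p).factorial ≤ m ^ (m * p) * p.factorial ^ m := by
  induction p with
  | zero => simp
  | succ p ih =>
    have h1 : (m * (p + 1)).factorial ≤ (m * p).factorial * (m * (p + 1)) ^ m := by
      rw [Nat.mul_succ, ← Nat.factorial_mul_ascFactorial]
      exact Nat.mul_le_mul_left _ (Nat.ascFactorial_le_pow_add _ _)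
    refine h1.trans ((Nat.mul_le_mul_right _ ih).trans_eq ?_)
    rw [Nat.factorial_succ, mul_pow, mul_pow, Nat.mul_succ, pow_add]
    ring

theorem factorial_mul_add_le (k p : ℕ) : ((k + 1) * p + k).factorial ≤
    (k + 1) ^ ((k + 1) * p) * p.factorial ^ (k + 1) * ((k + 1) * (p + 1)) ^ k := by
  rw [← Nat.factorial_mul_ascFactorial]
  refine Nat.mul_le_mul (factorial_mul_le _ _) ((Nat.ascFactorial_le_pow_add _ _).trans ?_)
  exact Nat.pow_le_pow_left (by nlinarith) _

theorem log_factorial_mul_add_le (k p : ℕ) : log ((k + 1) * p + k).factorial ≤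
    (k + 1) * p * log (k + 1) + (k + 1) * log p.factorial + k * (log (k + 1) + log (p + 1)) := by
  have h : (((k + 1) * p + k).factorial : ℝ) ≤
      ((k : ℝ) + 1) ^ ((k + 1) * p) * (p.factorial : ℝ) ^ (k + 1) *
        (((k : ℝ) + 1) * (p + 1)) ^ k := by
    exact_mod_cast factorial_mul_add_le k p
  have hp := Nat.factorial_ne_zero p
  refine (log_le_log (by positivity) h).trans_eq ?_
  rw [log_mul (by positivity) (by positivity), log_mul (by positivity) (by positivity), log_pow,
    log_pow, log_pow, log_mul (by positivity) (by positivity)]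
  push_cast
  ring

/-- The Stirling sequence decreases from its first value `e / √2`. -/
theorem log_factorial_le {k : ℕ} (hk : k ≠ 0) :
    log k.factorial ≤ k * log k - k + log k / 2 + 1 := by
  obtain ⟨m, rfl⟩ := Nat.exists_eq_succ_of_ne_zero hk
  have h : Stirling.stirlingSeq (m + 1) ≤ Stirling.stirlingSeq 1 :=
    Stirling.stirlingSeq'_antitone (Nat.zero_le m)
  rw [Stirling.stirlingSeq_one, Stirling.stirlingSeq, div_le_iff₀ (by positivity)] at h
  have h2 := log_le_log (by positivity) h
  refine h2.trans_eq ?_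
  rw [log_mul (by positivity) (by positivity), log_mul (by positivity) (by positivity),
    log_div (by positivity) (by positivity), log_pow, log_div (by positivity) (by positivity),
    sqrt_mul (by norm_num), log_mul (by positivity) (by positivity), log_sqrt (by positivity),
    log_sqrt (by positivity), log_exp]
  push_cast
  ring

/-- The tangent to the concave logarithm at `y`; taking `y` close to `x` makes the numerical
inequalities linear. -/
theorem log_le_log_add_div_sub_one {x y : ℝ} (hx : 0 < x) (hy : 0 < y) :
    log x ≤ log y + x / y - 1 := by
  have := log_le_sub_one_of_pos (div_pos hx hy)
  rw [log_div hx.ne' hy.ne'] at this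
  linarith

/-- Elementary bounds for `s(2, k)`. -/
theorem s_two_ge {k : ℕ} (hk : 2 ≤ k) : 7.68 ≤ s 2 k ∧
    2 * log k + k / 2 + log k.factorial + 2 * log k + log (k + 1) + 1.55 ≤ 2 * s 2 k := by
  have hk2 : (2 : ℝ) ≤ k := by exact_mod_cast hk
  have l2 := log_two_gt_d9
  have hl4 : 2 * log 2 ≤ log ((k : ℝ) + 2) := by
    rw [show 2 * log 2 = log (2 ^ 2) by rw [log_pow]; norm_num]
    exact log_le_log (by norm_num) (by linarith)
  have hs : s 2 k = ((k : ℝ) + 2) * log ((k : ℝ) + 2) ^ 2 := by simp [s]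
  set l := log ((k : ℝ) + 2) with hl
  have h1 : log k ≤ l := log_le_log (by linarith) (by linarith)
  have h2 : log (k + 1) ≤ l := log_le_log (by linarith) (by linarith)
  have h3 : log k.factorial ≤ k * l := by
    have h : (k.factorial : ℝ) ≤ (k : ℝ) ^ k := by exact_mod_cast Nat.factorial_le_pow k
    have := log_le_log (by positivity) h
    rw [log_pow] at this
    exact this.trans (by gcongr)
  have hl1 : 1.386 ≤ l := by linarith
  rw [hs]
  have h5 : 1.386 * l ≤ l ^ 2 := by nlinarith
  constructor
  · have : 1.386294 ^ 2 ≤ l ^ 2 := by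
      apply pow_le_pow_left₀ (by norm_num); linarith
    nlinarith
  · nlinarith

theorem sq_le_exp {B : ℝ} (hB : 7.68 ≤ B) : B ^ 2 ≤ 0.03 * exp B := by
  have hB0 : 0 < B := by linarith
  have h := log_le_log_add_div_sub_one hB0 (show (0 : ℝ) < 2 ^ 3 by norm_num)
  rw [log_pow] at h
  have l2 := log_two_lt_d9
  have l3 := log_three_lt_d9
  have h36 : log (100 / 3) ≤ 2 * log 2 + 2 * log 3 := by
    rw [show 2 * log 2 + 2 * log 3 = log (2 ^ 2 * 3 ^ 2) by
      rw [log_mul (by norm_num) (by norm_num), log_pow, log_pow]; norm_num]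
    exact log_le_log (by norm_num) (by norm_num)
  have h2 : log (B ^ 2 * (100 / 3)) ≤ B := by
    rw [log_mul (by positivity) (by norm_num), log_pow]
    push_cast at h ⊢
    linarith
  have := (log_le_iff_le_exp (by positivity)).1 h2
  linarith

/-- An admissible constant `c` such that the order of the approximation is at most
`c log H / log log H`. -/
def IsAdmissible (k : ℕ) (c : ℝ) : Prop :=
  1 ≤ c ∧ c ≤ 2 ∧
  (∀ B, s 2 k ≤ B →
    B + 0.1 ≤ c * (B - log B - 1.1 + log 2 - (log k.factorial - 2 * log 2))) ∧
  c * ((k + 1) * log (k + 1) + k * (log k.factorial - 2 * log 2)) + 0.12 * k ≤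
    k ^ 2 * log k * factor k

/-- For `k = 2, 3, 4` the tangent point (8, 12, 18) is a product of powers of 2 and 3 near the least
possible `B`, namely `s 2 k`. -/
theorem isAdmissible_two : IsAdmissible 2 (3 / 2) := by
  have l2 := log_two_gt_d9
  have l2' := log_two_lt_d9
  have l3' := log_three_lt_d9
  refine ⟨by norm_num, by norm_num, fun B hB => ?_, ?_⟩
  · have hB' := (s_two_ge le_rfl).1.trans hB
    have h := log_le_log_add_div_sub_one (show 0 < B by linarith) (show (0 : ℝ) < 2 ^ 3 by norm_num)
    rw [log_pow] at h
    norm_num [Nat.factorial] at h ⊢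
    linarith
  · norm_num [Nat.factorial, factor]
    linarith

theorem isAdmissible_three : IsAdmissible 3 (3 / 2) := by
  have l2 := log_two_gt_d9
  have l2' := log_two_lt_d9
  have l3 := log_three_gt_d9
  have l3' := log_three_lt_d9
  have l5 := log_five_gt_d9
  have l4 : log 4 = 2 * log 2 := by rw [show (4 : ℝ) = 2 ^ 2 by norm_num, log_pow]; norm_num
  have l6 : log 6 = log 2 + log 3 := by
    rw [show (6 : ℝ) = 2 * 3 by norm_num, log_mul (by norm_num) (by norm_num)]
  refine ⟨by norm_num, by norm_num, fun B hB => ?_, ?_⟩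
  · have hB' : 12.95 ≤ B := by
      refine le_trans ?_ hB
      norm_num [s]
      nlinarith
    have h := log_le_log_add_div_sub_one (show 0 < B by linarith)
      (show (0 : ℝ) < 2 ^ 2 * 3 by norm_num)
    rw [log_mul (by norm_num) (by norm_num), log_pow] at h
    norm_num [Nat.factorial, l6] at h ⊢
    linarith
  · norm_num [Nat.factorial, factor, l6, l4]
    linarith

theorem isAdmissible_four : IsAdmissible 4 (3 / 2) := by
  have l2 := log_two_gt_d9
  have l2' := log_two_lt_d9
  have l3 := log_three_gt_d9
  have l3' := log_three_lt_d9
  have l5' := log_five_lt_d9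
  have l4 : log 4 = 2 * log 2 := by rw [show (4 : ℝ) = 2 ^ 2 by norm_num, log_pow]; norm_num
  have l6 : log 6 = log 2 + log 3 := by
    rw [show (6 : ℝ) = 2 * 3 by norm_num, log_mul (by norm_num) (by norm_num)]
  have l24 : log 24 = 3 * log 2 + log 3 := by
    rw [show (24 : ℝ) = 2 ^ 3 * 3 by norm_num, log_mul (by norm_num) (by norm_num), log_pow]
    norm_num
  refine ⟨by norm_num, by norm_num, fun B hB => ?_, ?_⟩
  · have hB' : 19.2 ≤ B := by
      refine le_trans ?_ hB
      norm_num [s, l6]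
      nlinarith
    have h := log_le_log_add_div_sub_one (show 0 < B by linarith)
      (show (0 : ℝ) < 2 * 3 ^ 2 by norm_num)
    rw [log_mul (by norm_num) (by norm_num), log_pow] at h
    norm_num [Nat.factorial, l24] at h ⊢
    linarith
  · norm_num [Nat.factorial, factor, l24, l4]
    linarith

/-- With `L = log k`, multiplication by `L` turns the factor `c` into `L + 1`. In `(L + 1)(k L - k)`
the terms linear in `L` cancel, leaving `k L² - k`; the same cancellation serves both inequalities.
-/
theorem isAdmissible_of_five_le {k : ℕ} (hk : 5 ≤ k) : IsAdmissible k (1 + 1 / log k) := by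
  have l2 := log_two_gt_d9
  have l2' := log_two_lt_d9
  have l5 := log_five_gt_d9
  have l5' := log_five_lt_d9
  have hk5 : (5 : ℝ) ≤ k := by exact_mod_cast hk
  have hk0 : (0 : ℝ) < k := by linarith
  have hM := log_factorial_le (show k ≠ 0 by omega)
  have hL5 : log 5 ≤ log k := log_le_log (by norm_num) hk5
  have hLup := log_le_log_add_div_sub_one hk0 (show (0 : ℝ) < 5 by norm_num)
  have hLsq : log k ^ 2 ≤ k := by
    have h := log_le_log_add_div_sub_one (sqrt_pos.2 hk0) (show (0 : ℝ) < 2 by norm_num)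
    rw [log_sqrt hk0.le] at h
    have : log k ≤ √k := by linarith
    calc log k ^ 2 ≤ √k ^ 2 := pow_le_pow_left₀ (by linarith) this 2
      _ = k := sq_sqrt hk0.le
  have hl1 : log k + 2 / (k + 2) ≤ log ((k : ℝ) + 2) := by
    have h := log_le_log_add_div_sub_one hk0 (show (0 : ℝ) < k + 2 by linarith)
    have e : (k : ℝ) / (k + 2) = 1 - 2 / (k + 2) := by field_simp; ring
    linarith
  have hl2 : log ((k : ℝ) + 2) ≤ log k + 0.4 := by
    have h := log_le_log_add_div_sub_one (show (0 : ℝ) < k + 2 by linarith) hk0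
    have e : ((k : ℝ) + 2) / k = 1 + 2 / k := by field_simp
    have : 2 / (k : ℝ) ≤ 0.4 := by rw [div_le_iff₀ hk0]; linarith
    linarith
  have hl3 : k * log ((k : ℝ) + 1) ≤ k * log k + 1 := by
    have h := log_le_log_add_div_sub_one (show (0 : ℝ) < k + 1 by linarith) hk0
    have e : (k : ℝ) * (log k + (k + 1) / k - 1) = k * log k + 1 := by field_simp; ring
    rw [← e]
    exact mul_le_mul_of_nonneg_left h hk0.le
  have hl4 : log ((k : ℝ) + 1) ≤ log k + 0.2 := by nlinarith
  have hs : s 2 k = ((k : ℝ) + 2) * log ((k : ℝ) + 2) ^ 2 := by simp [s]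
  set L := log (k : ℝ) with hL
  set l := log ((k : ℝ) + 2) with hl
  have hLpos : 0 < L := by linarith
  refine ⟨by simp [hLpos.le], ?_, fun B hB => ?_, ?_⟩
  · have : 1 / L ≤ 1 := by rw [div_le_one hLpos]; linarith
    linarith
  · have hslow : (k + 2) * L ^ 2 + 4 * L ≤ s 2 k := by
      have h : (L + 2 / (k + 2)) ^ 2 ≤ l ^ 2 := pow_le_pow_left₀ (by positivity) hl1 2
      have e : ((k : ℝ) + 2) * (L + 2 / (k + 2)) ^ 2 = (k + 2) * L ^ 2 + 4 * L + 4 / (k + 2) := by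
        field_simp; ring
      have : 0 ≤ 4 / ((k : ℝ) + 2) := by positivity
      rw [hs]
      nlinarith
    have hs0 : 0 < s 2 k := lt_of_lt_of_le (by positivity) hslow
    have hlogs : log (s 2 k) ≤ 2 * L + 0.188 := by
      have h := log_le_log_add_div_sub_one (show 0 < l by linarith [show 0 < 2 / ((k : ℝ) + 2) by positivity])
        (show (0 : ℝ) < 2 by norm_num)
      have hl0 : l ≠ 0 := by
        have : 0 < 2 / ((k : ℝ) + 2) := by positivity
        linarith
      rw [hs, log_mul (by positivity) (pow_ne_zero 2 hl0), log_pow, ← hl]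
      push_cast
      linarith
    have hLs : L + 1 ≤ s 2 k := by nlinarith
    have hBlog := log_le_log_add_div_sub_one (hs0.trans_le hB) hs0
    have hdiv : (L + 1) * (B / s 2 k - 1) ≤ B - s 2 k := by
      have e : B / s 2 k - 1 = (B - s 2 k) / s 2 k := by field_simp
      rw [e, mul_div_assoc', div_le_iff₀ hs0]
      nlinarith
    -- Here `0.021` exceeds `2.1 - 3 log 2`, the sum of the constants in `1.1 - log 2 + log (k!/4)`.
    -- The excess `L² / 2` over `s 2 k` is absorbed by `-k`, as `L² ≤ k`.
    have hmain : (L + 1) * (2 * L + 0.188 + k * L - k + L / 2 + 0.021) + 0.1 * L ≤ s 2 k := by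
      nlinarith
    have hK : (L + 1) * (log B + 1.1 - log 2 + (log k.factorial - 2 * log 2)) ≤
        (L + 1) * ((2 * L + 0.188 + k * L - k + L / 2 + 0.021) + (B / s 2 k - 1)) := by
      refine mul_le_mul_of_nonneg_left ?_ (by linarith)
      linarith
    have e : (1 + 1 / L) * (B - log B - 1.1 + log 2 - (log k.factorial - 2 * log 2)) =
        ((L + 1) * B - (L + 1) * (log B + 1.1 - log 2 + (log k.factorial - 2 * log 2))) / L := by
      field_simp; ring
    rw [e, le_div_iff₀ hLpos]
    linarith
  · have hfac : k ^ 2 * L * factor k = k ^ 2 * L + 0.69 * k ^ 2 * (L / (L - 1)) := by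
      rw [factor, if_neg (by omega), if_neg (by omega), if_neg (by omega), ← hL]
      have : L - 1 ≠ 0 := by linarith
      field_simp
    have hge : 1 ≤ L / (L - 1) := by rw [le_div_iff₀ (by linarith)]; linarith
    have hN : (k + 1) * log ((k : ℝ) + 1) + k * (log k.factorial - 2 * log 2) ≤
        k ^ 2 * L - k ^ 2 + 1.5 * k * L + L - 0.386 * k + 1.2 := by
      have : (k : ℝ) * (log k.factorial - 2 * log 2) ≤ k * (k * L - k + L / 2 - 0.386) := by
        refine mul_le_mul_of_nonneg_left ?_ hk0.le
        linarith
      linarith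
    have e : (1 + 1 / L) * (k ^ 2 * L - k ^ 2 + 1.5 * k * L + L - 0.386 * k + 1.2) =
        (L + 1) * (k ^ 2 * L - k ^ 2 + 1.5 * k * L + L - 0.386 * k + 1.2) / L := by
      field_simp
    have hup : L ≤ 0.2 * k + 0.61 := by linarith
    have hkL : 0 < k * L := by positivity
    have hfin : (L + 1) * (k ^ 2 * L - k ^ 2 + 1.5 * k * L + L - 0.386 * k + 1.2) ≤
        (k ^ 2 * L + 0.69 * k ^ 2 - 0.12 * k) * L := by
      have h1 : k * L * L ≤ k * L * (0.2 * k + 0.61) := by gcongr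
      have h2 : k * L ≤ k * (0.322 * k) := by
        gcongr
        linarith
      have h3 : k * L * 5 ≤ k * L * k := by gcongr
      have h4 : 5 * L ≤ k * L := by gcongr
      have h5 : L * L ≤ L * (0.2 * k + 0.61) := by gcongr
      linarith
    rw [hfac]
    have h0 : (1 + 1 / L) * ((k + 1) * log ((k : ℝ) + 1) + k * (log k.factorial - 2 * log 2)) ≤
        (1 + 1 / L) * (k ^ 2 * L - k ^ 2 + 1.5 * k * L + L - 0.386 * k + 1.2) := by
      gcongr
    rw [e] at h0
    have h1 := (div_le_iff₀ hLpos).2 hfin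
    have h2 : 0.69 * (k : ℝ) ^ 2 * 1 ≤ 0.69 * k ^ 2 * (L / (L - 1)) := by gcongr
    linarith

theorem exists_isAdmissible {k : ℕ} (hk : 2 ≤ k) : ∃ c, IsAdmissible k c := by
  by_cases h : 5 ≤ k
  · exact ⟨_, isAdmissible_of_five_le h⟩
  · interval_cases k
    exacts [⟨_, isAdmissible_two⟩, ⟨_, isAdmissible_three⟩, ⟨_, isAdmissible_four⟩]

end RootsOfE

/-! ### Choice of the order `p` and conclusion. -/

namespace RootsOfE
open Real

/-- The least order `p` of approximation that is good enough: its predecessor is not. -/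
theorem exists_lt_factorial_and_factorial_le {T a : ℝ} (hT : 1 ≤ T) :
    ∃ q : ℕ, T * a ^ (q + 1) < (q + 1).factorial ∧ (q.factorial : ℝ) ≤ T * a ^ q := by
  have hex : ∃ p : ℕ, T * a ^ p < p.factorial := by
    have h := (FloorSemiring.tendsto_pow_div_factorial_atTop a).const_mul T
    rw [mul_zero] at h
    obtain ⟨p, hp⟩ := (h.eventually (gt_mem_nhds one_pos)).exists
    refine ⟨p, ?_⟩
    rwa [mul_div_assoc', div_lt_one (by positivity)] at hp
  classical
  -- `T ≥ 1 = 0!` rules out order 0, so the least order has a predecessor.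
  have h0 : Nat.find hex ≠ 0 := by
    intro h0
    have := Nat.find_spec hex
    rw [h0] at this
    simp at this
    linarith
  obtain ⟨q, hq⟩ := Nat.exists_eq_succ_of_ne_zero h0
  refine ⟨q, ?_, not_lt.1 (Nat.find_min hex (by omega))⟩
  have := Nat.find_spec hex
  rwa [hq] at this

theorem s_two_le {n k : ℕ} (hn : 2 ≤ n) : s 2 k ≤ s n k := by
  have hn2 : (2 : ℝ) ≤ n := by exact_mod_cast hn
  have hk : (0 : ℝ) ≤ k := Nat.cast_nonneg k
  have h0 : 0 ≤ log ((k : ℝ) + (2 : ℕ)) := log_nonneg (by push_cast; linarith)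
  unfold s
  gcongr

/-- The order of approximation is at most `c log H / log log H`. -/
theorem le_mul_div_log {c A B M P t p : ℝ} (hc1 : 1 ≤ c) (hB : 7.68 ≤ B) (hA : log A = B)
    (hA0 : 0 < A) (hBA : B ^ 2 ≤ 0.03 * A)
    (hD : B + 0.1 ≤ c * (B - log B - 1.1 + log 2 - M)) (hP : log 2 - M ≤ P) (ht : t ≤ 2 * B)
    (h : p * log p - p + p * P ≤ A + t + log p) : p ≤ c * (A / B) := by
  by_contra! hlt
  have hB0 : 0 < B := by linarith
  have hX : B / 0.03 ≤ A / B := by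
    rw [div_le_div_iff₀ (by norm_num) hB0]
    linarith
  have hX0 : 0 < A / B := by positivity
  have hXp : A / B ≤ p := (le_mul_of_one_le_left hX0.le hc1).trans hlt.le
  have hp0 : 0 < p := hX0.trans_le hXp
  have hlogX : B - log B ≤ log p := by
    rw [← hA, ← log_div hA0.ne' (hA ▸ hB0.ne'), hA]
    exact log_le_log hX0 hXp
  have h50 : 50 ≤ p := by
    have : 50 ≤ B / 0.03 := by rw [le_div_iff₀ (by norm_num)]; linarith
    linarith
  have hlogp : log p ≤ 0.1 * p := by
    have h := log_le_log_add_div_sub_one hp0 (show (0 : ℝ) < 2 ^ 4 by norm_num)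
    rw [log_pow] at h
    have := log_two_lt_d9
    push_cast at h
    linarith
  set D := B - log B - 1.1 + log 2 - M with hDdef
  have hD0 : 0 < D := by
    by_contra! hneg
    have := mul_nonpos_of_nonneg_of_nonpos (by linarith : 0 ≤ c) hneg
    linarith
  -- The `1.1` in `D` is 1 from Stirling's `-p` plus `0.1` from `log p ≤ 0.1 p`.
  have h1 : p * D ≤ A + 2 * B := by
    have : p * D ≤ p * (log p - 1.1 + P) := by
      refine mul_le_mul_of_nonneg_left ?_ hp0.le
      linarith
    linarith
  have h2 : c * (A / B) * D ≤ p * D := by gcongr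
  have h3 : A / B * (B + 0.1) ≤ A / B * (c * D) := by gcongr
  have h4 : A / B * B = A := div_mul_cancel₀ _ hB0.ne'
  have h5 : B / 0.03 = B * (100 / 3) := by norm_num [div_eq_mul_inv]
  rw [h5] at hX
  -- Together these give `0.1 A / B ≤ 2 B`, against `A / B ≥ (100/3) B`.
  linarith

theorem rpow_neg_explicitExponent_lt (n k : ℕ) (hn : 2 ≤ n) (hnk : n ≤ k) (H : ℝ) (hH : 1 ≤ H)
    (hlog : s n k * exp (s n k) ≤ log H) (c : Fin (k + 1) → ℤ) (hc : c ≠ 0)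
    (hcH : ∀ i, i ≠ 0 → |(c i : ℝ)| ≤ H) :
    H ^ (-explicitExponent k H) <
      |∑ i, (c i : ℝ) * exp (((i : ℕ) : ℝ) / (n : ℝ))| := by
  have hk : 2 ≤ k := hn.trans hnk
  have hH0 : 0 < H := by linarith
  have hk2 : (2 : ℝ) ≤ k := by exact_mod_cast hk
  have hn2 : (2 : ℝ) ≤ n := by exact_mod_cast hn
  have hnk' : (n : ℝ) ≤ k := by exact_mod_cast hnk
  obtain ⟨hs1, hs2⟩ := s_two_ge hk
  have hs := s_two_le (k := k) hn
  obtain ⟨γ, hγ1, hγ2, hγB, hγ⟩ := exists_isAdmissible hk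
  set A := log H with hA
  have hsA : exp (s n k) ≤ A :=
    (le_mul_of_one_le_left (exp_pos _).le (by linarith)).trans hlog
  have hA0 : 0 < A := (exp_pos _).trans_le hsA
  set B := log A with hB
  have hsB : s 2 k ≤ B := hs.trans ((le_log_iff_exp_le hA0).2 hsA)
  have hB7 : 7.68 ≤ B := hs1.trans hsB
  have hB0 : 0 < B := by linarith
  have hBA : B ^ 2 ≤ 0.03 * A := by
    have := sq_le_exp hB7
    rwa [hB, exp_log hA0, ← hB] at this
  have l2 := log_two_gt_d9
  have l2' := log_two_lt_d9
  have hk0 : (0 : ℝ) < k := by linarith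
  have hn0 : (0 : ℝ) < n := by linarith
  have hkf : (k : ℝ) ≤ k.factorial := by exact_mod_cast Nat.self_le_factorial k
  set T : ℝ := k ^ 2 * exp (k / 2) * k.factorial with hT
  set a : ℝ := k.factorial / (4 * n) with ha
  have hf0 : (0 : ℝ) < k.factorial := by linarith
  have ha0 : 0 < a := by positivity
  have hT0 : 0 < T := by positivity
  have hTH : 1 ≤ T * H := by
    have h1 : 1 ≤ (k : ℝ) ^ 2 := one_le_pow₀ (by linarith)
    have h2 : 1 ≤ exp ((k : ℝ) / 2) := one_le_exp (by positivity)
    have h3 : 1 ≤ (k.factorial : ℝ) := by linarith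
    exact one_le_mul_of_one_le_of_one_le (one_le_mul_of_one_le_of_one_le
      (one_le_mul_of_one_le_of_one_le h1 h2) h3) hH
  have hlogT : log T = 2 * log k + k / 2 + log k.factorial := by
    rw [hT, log_mul (by positivity) (by positivity), log_mul (by positivity) (by positivity),
      log_pow, log_exp]
    norm_num
  set M := log k.factorial - 2 * log 2 with hM
  have hloga : log a = M - log n := by
    rw [ha, log_div (by positivity) (by positivity), log_mul (by norm_num) (by positivity),
      show (4 : ℝ) = 2 ^ 2 by norm_num, log_pow, hM]
    push_cast; ring
  have hlogk0 : log 2 ≤ log k := log_le_log (by norm_num) hk2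
  have hlogn : log 2 ≤ log n := log_le_log (by norm_num) hn2
  have hlognk : log n ≤ log k := log_le_log hn0 hnk'
  have hlogf : log k ≤ log k.factorial := log_le_log hk0 hkf
  have hlogk1 : log k ≤ log (k + 1) := log_le_log hk0 (by linarith)
  obtain ⟨q, hq1, hq2⟩ := exists_lt_factorial_and_factorial_le (a := a) hTH
  have hmain := half_lt_abs_linearForm_mul hn (by omega) hH0.le c hc hcH hq1
  set Λ := |∑ i, (c i : ℝ) * exp (((i : ℕ) : ℝ) / (n : ℝ))| with hΛ
  set p := q + 1 with hp
  have hp1 : (1 : ℝ) ≤ p := by rw [hp]; push_cast; linarith [(Nat.cast_nonneg q : (0 : ℝ) ≤ q)]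
  have hp0 : (0 : ℝ) < p := by linarith
  have hpf : (0 : ℝ) < p.factorial := by positivity
  have hlogp0 : 0 ≤ log (p : ℝ) := log_nonneg hp1
  -- the predecessor of `p` is not good enough
  have hpred : log p.factorial - log p ≤ log T + A + (p - 1) * (M - log n) := by
    have h := log_le_log (by positivity) hq2
    rw [log_mul (by positivity) (by positivity), log_mul (by positivity) (by positivity), log_pow,
      hloga] at h
    have e : log (p.factorial : ℝ) = log p + log q.factorial := by
      rw [hp, Nat.factorial_succ, Nat.cast_mul, log_mul (by positivity) (by positivity)]
    have e2 : (p : ℝ) - 1 = q := by rw [hp]; push_cast; ring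
    rw [e, e2]
    linarith
  have hstir : (p : ℝ) * log p - p ≤ log p.factorial := by
    have h := Stirling.le_log_factorial_stirling (n := p) (by omega)
    have : 0 ≤ log (2 * π) := log_nonneg (by linarith [pi_gt_three])
    linarith
  have hpX : (p : ℝ) ≤ γ * (A / B) := by
    refine le_mul_div_log (M := M) (P := log n - M) (t := log T + 2 * log 2) hγ1 hB7 rfl hA0 hBA
      (hγB B hsB) (by linarith) ?_ ?_
    · rw [hlogT]; linarith
    · linarith
  have hX0 : 0 < A / B := by positivity
  have hlogp : log p ≤ B - log 2 := by
    have h1 : log p ≤ log (2 * (A / B)) :=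
      log_le_log hp0 (hpX.trans (by gcongr))
    rw [log_mul (by norm_num) hX0.ne', log_div hA0.ne' hB0.ne', ← hB] at h1
    have h2 : log (2 ^ 2) ≤ log B := log_le_log (by norm_num) (by linarith)
    rw [log_pow] at h2
    push_cast at h2
    linarith
  have hlogp1 : log ((p : ℝ) + 1) ≤ B := by
    have h1 : log ((p : ℝ) + 1) ≤ log (2 * p) := log_le_log (by positivity) (by linarith)
    rw [log_mul (by norm_num) hp0.ne'] at h1
    linarith
  -- the main estimate
  have hfac := log_factorial_mul_add_le k p
  -- Not automatic: `M` is negative for `k = 2`.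
  have hN0 : 0 ≤ (k + 1) * log ((k : ℝ) + 1) + k * M := by
    have h1 : (k : ℝ) * (-log 2) ≤ k * M := mul_le_mul_of_nonneg_left (by linarith) hk0.le
    have h2 : (k : ℝ) * log 2 ≤ k * log ((k : ℝ) + 1) :=
      mul_le_mul_of_nonneg_left (by linarith) hk0.le
    linarith
  have hmul : (p : ℝ) * ((k + 1) * log ((k : ℝ) + 1) + k * M) ≤
      γ * (A / B) * ((k + 1) * log ((k : ℝ) + 1) + k * M) := by gcongr
  -- Powers of `n` cancel between `n^{k(p+1)}` and the predecessor bound, up to `2 k log n`; here `n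
  -- ≤ k` enters.
  have herr : log 2 + k * (log ((k : ℝ) + 1) + log (p + 1) + log p + log T + 2 * log n + 1 / 2 - M)
      ≤ k * (4 * B) := by
    have h1 : log 2 ≤ k * (log 2 / 2) := by linarith [mul_le_mul_of_nonneg_right hk2 (by linarith : 0 ≤ log 2)]
    have h2 : (k : ℝ) * (log 2 / 2 + (log ((k : ℝ) + 1) + log (p + 1) + log p + log T + 2 * log n
        + 1 / 2 - M)) ≤ k * (4 * B) := by
      refine mul_le_mul_of_nonneg_left ?_ hk0.le
      rw [hlogT]
      linarith
    linarith
  -- This is the slack `0.12 k` kept in the last clause of `IsAdmissible`.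
  have hBX : k * (4 * B) ≤ A / B * (0.12 * k) := by
    have : B ≤ 0.03 * (A / B) := by
      rw [mul_div_assoc', le_div_iff₀ hB0]
      linarith
    have := mul_le_mul_of_nonneg_left this (by linarith : 0 ≤ 4 * (k : ℝ))
    linarith
  have hγX := mul_le_mul_of_nonneg_left hγ hX0.le
  have hkpred := mul_le_mul_of_nonneg_left hpred hk0.le
  have hω : explicitExponent k H * A = k * A + A / B * (k ^ 2 * log k * factor k) := by
    rw [explicitExponent, ← hA, ← hB]
    field_simp
  have hΛ0 : 0 < Λ := by
    by_contra! h
    have := mul_nonpos_of_nonpos_of_nonneg h (show 0 ≤ (((k + 1) * p + k).factorial / p.factorial *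
      (n : ℝ) ^ (k * (p + 1)) * exp (k / 2)) by positivity)
    linarith
  have hlogmain := log_lt_log (by norm_num) hmain
  rw [log_mul hΛ0.ne' (by positivity), log_mul (by positivity) (by positivity),
    log_mul (by positivity) (by positivity), log_div (by positivity) hpf.ne', log_pow, log_exp,
    one_div, log_inv] at hlogmain
  push_cast at hlogmain
  rw [rpow_def_of_pos hH0, ← lt_log_iff_exp_lt hΛ0, ← hA]
  linarith

theorem optimalExponent_le {ξ : ℝ} {k : ℕ} {H r : ℝ} (hr : 0 < r)
    (h : IsLowerBoundExponent ξ k H r) : optimalExponent ξ k H ≤ r :=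
  csInf_le ⟨0, fun _ hx => hx.1.le⟩ ⟨hr, h⟩

/-- Needed because the infimum runs over positive `r` only. -/
theorem explicitExponent_pos {n k : ℕ} (hn : 2 ≤ n) (hnk : n ≤ k) {H : ℝ}
    (hlog : s n k * exp (s n k) ≤ log H) : 0 < explicitExponent k H := by
  have hk : 2 ≤ k := hn.trans hnk
  have hk2 : (2 : ℝ) ≤ k := by exact_mod_cast hk
  have hs1 := (s_two_ge hk).1.trans (s_two_le hn)
  have hA : 1 ≤ log H := le_trans (one_le_mul_of_one_le_of_one_le (by linarith)
    (one_le_exp (by linarith))) hlog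
  have hf : 0 ≤ factor k := by
    unfold factor
    split_ifs with h2 h3 h4
    · norm_num
    · norm_num
    · norm_num
    · have h5 : log 5 ≤ log k :=
        log_le_log (by norm_num) (by exact_mod_cast (show 5 ≤ k by omega))
      have := log_five_gt_d9
      have : 0 < log k - 1 := by linarith
      positivity
  have h1 : 0 ≤ log (k : ℝ) := log_nonneg (by linarith)
  have h2 : 0 ≤ log (log H) := log_nonneg hA
  unfold explicitExponent
  positivity

end RootsOfE

theorem theorem1 (n k : ℕ) (hn : 2 ≤ n) (hnk : n ≤ k) (H : ℝ) (hH : 1 ≤ H)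
    (hlog : RootsOfE.s n k * Real.exp (RootsOfE.s n k) ≤ Real.log H) :
    (∀ c : Fin (k + 1) → ℤ, c ≠ 0 → (∀ i, i ≠ 0 → |(c i : ℝ)| ≤ H) →
      |∑ i, (c i : ℝ) * Real.exp (((i : ℕ) : ℝ) / (n : ℝ))|
        > H ^ (-RootsOfE.explicitExponent k H)) ∧
    RootsOfE.optimalExponent (Real.exp (1 / (n : ℝ))) k H ≤ RootsOfE.explicitExponent k H := by
  have h := RootsOfE.rpow_neg_explicitExponent_lt n k hn hnk H hH hlog
  refine ⟨fun c hc hcH => h c hc hcH,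
    RootsOfE.optimalExponent_le (RootsOfE.explicitExponent_pos hn hnk hlog) fun c hc hcH => ?_⟩
  have := h c hc hcH
  rw [Real.rpow_neg (by linarith), ← one_div] at this
  refine this.trans_eq ?_
  congr 1
  refine Finset.sum_congr rfl fun i _ => ?_
  rw [← Real.exp_nat_mul]
  congr 2
  ring
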